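/- For a finite group $G$ and a finite dimensional complex representation $V$ of $G$, let $\beta_{\mathrm{sep}}(G,V)$ be the minimal positive integer $d$ such that for any $v,w\in V$ with different $G$-orbits there exists a homogeneous $G$-invariant polynomial function $f\in\mathbb{C}[V]^G$ of degree at most $d$ with $f(v)\neq f(w)$. The separating Noether number of $G$ is $\beta_{\mathrm{sep}}(G):=\sup_V \beta_{\mathrm{sep}}(G,V)$, where $V$ ranges over all finite dimensional complex representations of $G$. Write $C_n$ for the cyclic group of order $n$. Theorem. Let $s\ge 1$ and let $n_1,\dots,n_{2s}$ be positive integers with $2\le n_{2s}$, with $n_{i+1}\mid n_i$ for $1\le i<2s$, and with $n_1=n_2=\dots=n_{s+1}$. Suppose that the smallest prime divisor $p$ of $n_1$ divides $n_{2s}$. Then $$\beta_{\mathrm{sep}}(C_{n_1}\oplus\dots\oplus C_{n_{2s}})=s\,n_1+\frac{n_1}{p}.$$ -/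

import Mathlib

/-- `f : V → ℂ` is a homogeneous polynomial function of degree `k` on the complex vector space `V`:
it is given by a homogeneous polynomial of degree `k` in linear functionals on `V`. -/
def IsHomogeneousPolyFun {V : Type*} [AddCommGroup V] [Module ℂ V] (k : ℕ) (f : V → ℂ) : Prop :=
  ∃ P : MvPolynomial (Module.Dual ℂ V) ℂ,
    P.IsHomogeneous k ∧ ∀ v : V, f v = MvPolynomial.eval (fun φ : Module.Dual ℂ V => φ v) P

/-- Any two points of `V` in different `G`-orbits are separated by a homogeneous `G`-invariant
polynomial function of degree at most `d`. -/
def SeparatesOrbitsInDegree {G V : Type*} [Group G] [AddCommGroup V] [Module ℂ V]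
    (ρ : Representation ℂ G V) (d : ℕ) : Prop :=
  ∀ v w : V, (¬ ∃ g : G, ρ g v = w) →
    ∃ (k : ℕ) (f : V → ℂ), k ≤ d ∧ IsHomogeneousPolyFun k f ∧
      (∀ (g : G) (u : V), f (ρ g u) = f u) ∧ f v ≠ f w

/-- `β_sep(G, V)`: the minimal positive integer `d` such that homogeneous invariants of degree at
most `d` separate the `G`-orbits in `V` (with value `⊤` if there is no such `d`). -/
noncomputable def betaSepRep {G V : Type*} [Group G] [AddCommGroup V] [Module ℂ V]
    (ρ : Representation ℂ G V) : ℕ∞ :=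
  ⨅ (d : ℕ) (_ : 0 < d ∧ SeparatesOrbitsInDegree ρ d), (d : ℕ∞)

/-- The separating Noether number `β_sep(G)`: the supremum, taken in `ℕ∞`, of `β_sep(G, V)` over
all finite dimensional complex representations `V` of `G`. (Each of them is isomorphic to one on
some `ℂ^m`, so that `V : Type` is no restriction.) -/
noncomputable def betaSep (G : Type*) [Group G] : ℕ∞ :=
  ⨆ (V : Type) (_ : AddCommGroup V) (_ : Module ℂ V) (_ : FiniteDimensional ℂ V)
    (ρ : Representation ℂ G V), betaSepRep ρ

/-! Write n = n_1 = p q and d = s n + q. In coordinates on which G acts by characters, invariants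
are spanned by monomials whose exponent vectors are relations between those characters.

Upper bound: if v and w agree on invariant monomials of degree at most d, they have the same
support, and the coordinate ratios w_i / v_i form a homomorphism on exponent vectors that kills all
short relations (nonnegative, of length at most d). By duality an element of G realises these ratios
once every relation is killed, so it suffices that short relations span all relations. As G has 2s
generators, relations supported on at most 2s + 1 characters span (`mem_of_forall_card_le`, by
Nakayama at each prime). For such a relation x, Dirichlet gives 0 < j < p with the coefficient sum
of j x within q of a multiple of n; then j x or -j x reduced mod n is short
(`mem_shortRelations_of_card_le`). Minimality of p makes j coprime to n, so x is recovered.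

Lower bound: 2s + 1 explicit characters have a relation of length d in which one chosen coefficient
is 1, while every shorter nonnegative relation has that coefficient divisible by p
(`le_sum_of_relations`). Multiplying that coordinate of (1, ..., 1) by a primitive p-th root of
unity changes the orbit, yet invariants of degree below d do not detect it. -/

section Relations

/-! ### Short relations in an abelian group -/

variable {S A : Type*} [Fintype S] [AddCommGroup A]

/-- The lattice spanned by the relations `∑ i, m i • g i = 0` with nonnegative coefficients whose
sum is at most `d`. -/
def shortRelations (g : S → A) (d : ℕ) : Submodule ℤ (S → ℤ) :=
  Submodule.span ℤ {m | (∀ i, 0 ≤ m i) ∧ ∑ i, m i ≤ d ∧ ∑ i, m i • g i = 0}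

theorem mem_shortRelations_of_dvd {g : S → A} {n d : ℕ} (hn : ∀ a : A, n • a = 0) (hd : n ≤ d)
    {x : S → ℤ} (hx : ∀ i, (n : ℤ) ∣ x i) : x ∈ shortRelations g d := by
  classical
  choose y hy using hx
  have : x = ∑ i, y i • Pi.single i (n : ℤ) := by
    ext j
    simp [Finset.sum_apply, Pi.single_apply, hy, mul_comm]
  rw [this]
  refine Submodule.sum_mem _ fun i _ => Submodule.smul_mem _ _ (Submodule.subset_span ⟨?_, ?_, ?_⟩)
  · intro j
    by_cases h : j = i
    · subst h; simp
    · simp [h]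
  · simpa using hd
  · rw [Finset.sum_eq_single i]
    · simpa using hn (g i)
    · intro j _ hj
      simp [hj]
    · simp

theorem mem_shortRelations_of_sum_emod_le {g : S → A} {n d : ℕ} (h0 : 0 < n)
    (hn : ∀ a : A, n • a = 0)
    (hd : n ≤ d) {x : S → ℤ} (hx : ∑ i, x i • g i = 0) (hlen : ∑ i, x i % (n : ℤ) ≤ d) :
    x ∈ shortRelations g d := by
  have h1 : (fun i => x i - x i % (n : ℤ)) ∈ shortRelations g d :=
    mem_shortRelations_of_dvd hn hd fun i => Int.dvd_self_sub_emod
  have h2 : (fun i => x i % (n : ℤ)) ∈ shortRelations g d := by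
    refine Submodule.subset_span ⟨fun i => Int.emod_nonneg _ (by omega), hlen, ?_⟩
    rw [← hx]
    refine Finset.sum_congr rfl fun i _ => ?_
    conv_rhs => rw [← Int.emod_add_mul_ediv (x i) n, add_smul, mul_comm, mul_smul]
    simp [hn]
  have := Submodule.add_mem _ h1 h2
  convert this using 1
  ext i
  simp

/-- A nonzero residue r is paired with n - r. Hence the reductions of x and -x cannot both be long.
-/
theorem sum_emod_add_sum_neg_emod {n : ℕ} (h0 : 0 < n) (x : S → ℤ) :
    ∑ i, x i % (n : ℤ) + ∑ i, (-x i) % (n : ℤ) =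
      n * (Finset.univ.filter fun i => ¬ (n : ℤ) ∣ x i).card := by
  rw [← Finset.sum_add_distrib, Finset.card_filter, Nat.cast_sum, Finset.mul_sum]
  refine Finset.sum_congr rfl fun i _ => ?_
  by_cases h : (n : ℤ) ∣ x i
  · simp [h, Int.emod_eq_zero_of_dvd h, Int.emod_eq_zero_of_dvd ((Int.dvd_neg).2 h)]
  · have h1 := Int.emod_nonneg (x i) (b := n) (by omega)
    have h2 := Int.emod_lt_of_pos (x i) (b := n) (by omega)
    have h3 : x i % (n : ℤ) ≠ 0 := fun h' => h (Int.dvd_of_emod_eq_zero h')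
    have h4 : (-x i) % (n : ℤ) = n - x i % (n : ℤ) := by
      rw [← Int.emod_eq_of_lt (a := n - x i % (n : ℤ)) (b := n) (by omega) (by omega),
        Int.emod_eq_emod_iff_emod_sub_eq_zero]
      refine Int.emod_eq_zero_of_dvd ?_
      obtain ⟨k, hk⟩ := Int.dvd_self_sub_emod (x := x i) (m := n)
      exact ⟨-1 - k, by linear_combination -hk⟩
    rw [h4]
    simp [h]

/-- Dirichlet approximation for the fraction `a / (p * q)`. -/
theorem exists_abs_mul_sub_le {p q : ℕ} (hp : 2 ≤ p) (hq : 0 < q) (a : ℤ) :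
    ∃ j m : ℤ, 0 < j ∧ j < p ∧ |j * a - m * (p * q)| ≤ q := by
  -- The bound p - 1 keeps j below p and gives error 1 / p, which becomes q after multiplication by
  -- p q.
  obtain ⟨m, j, hj, hj', h⟩ := Real.exists_int_int_abs_mul_sub_le ((a : ℝ) / (p * q))
    (n := p - 1) (by omega)
  refine ⟨j, m, hj, by omega, ?_⟩
  have hp0 : (0 : ℝ) < p := by positivity
  have hq0 : (0 : ℝ) < q := by positivity
  rw [Nat.cast_sub (by omega), Nat.cast_one, sub_add_cancel] at h
  have h2 := mul_le_mul_of_nonneg_right h (by positivity : (0 : ℝ) ≤ p * q)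
  have h3 : (0 : ℝ) ≤ (p * q : ℝ) := by positivity
  rw [← abs_of_nonneg h3, ← abs_mul, abs_of_nonneg h3] at h2
  have h4 : ((j : ℝ) * (a / (p * q)) - m) * (p * q) = ((j * a - m * (p * q) : ℤ) : ℝ) := by
    push_cast
    field_simp
  have h5 : 1 / (p : ℝ) * (p * q) = ((q : ℤ) : ℝ) := by
    push_cast
    field_simp
  rw [h4, h5, ← Int.cast_abs] at h2
  exact_mod_cast h2

/-- The residues mod n of j x and of -j x have total at most (2s + 1) n. When the first sum is
within q of a multiple of n, one of the two is at most s n + q. -/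
theorem mem_shortRelations_of_card_le {g : S → A} {p q s : ℕ} (hs : 1 ≤ s) (hp : 2 ≤ p) (hq : 0 < q)
    (hpmin : ∀ j, 0 < j → j < p → j.Coprime (p * q)) (hn : ∀ a : A, (p * q) • a = 0)
    {x : S → ℤ} (hx : ∑ i, x i • g i = 0)
    (hcard : (Finset.univ.filter fun i => x i ≠ 0).card ≤ 2 * s + 1) :
    x ∈ shortRelations g (s * (p * q) + q) := by
  obtain ⟨j, m, hj, hjp, hjm⟩ := exists_abs_mul_sub_le hp hq (∑ i, x i)
  set n := p * q with hndef
  have hn0 : 0 < n := by positivity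
  have hnd : n ≤ s * n + q := by nlinarith
  have hy : j • x ∈ shortRelations g (s * n + q) := by
    have hjx : ∑ i, (j • x) i • g i = 0 := by
      simp only [Pi.smul_apply, smul_assoc, ← Finset.smul_sum, hx, smul_zero]
    have hjx' : ∑ i, (-(j • x)) i • g i = 0 := by
      simp only [Pi.neg_apply, neg_smul, Finset.sum_neg_distrib, hjx, neg_zero]
    have hk := sum_emod_add_sum_neg_emod hn0 (j • x)
    set k := (Finset.univ.filter fun i => ¬ (n : ℤ) ∣ (j • x) i).card
    have hk' : k ≤ 2 * s + 1 := by
      refine (Finset.card_le_card ?_).trans hcard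
      intro i
      simp only [Finset.mem_filter, Finset.mem_univ, true_and]
      intro h h'
      simp [h'] at h
    have hmod : (n : ℤ) ∣ (∑ i, (j • x) i % (n : ℤ)) - (j * ∑ i, x i - m * (p * q)) := by
      have e : (∑ i, (j • x) i % (n : ℤ)) - (j * ∑ i, x i - m * (p * q)) =
          m * n - ∑ i, ((j • x) i - (j • x) i % (n : ℤ)) := by
        rw [Finset.sum_sub_distrib, Finset.mul_sum, hndef]
        simp
        ring
      rw [e]
      exact dvd_sub (dvd_mul_left _ _) (Finset.dvd_sum fun i _ => Int.dvd_self_sub_emod)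
    obtain ⟨c, hc⟩ := hmod
    set b := j * ∑ i, x i - m * (p * q)
    have hb := abs_le.mp hjm
    -- The residues of j x sum to b + c n with |b| ≤ q, those of -j x to (k - c) n - b. Since k ≤ 2s
    -- + 1, either c ≤ s or k - c ≤ s.
    by_cases hcs : c ≤ s
    · refine mem_shortRelations_of_sum_emod_le hn0 hn hnd hjx ?_
      push_cast
      nlinarith
    · rw [← Submodule.neg_mem_iff]
      refine mem_shortRelations_of_sum_emod_le hn0 hn hnd hjx' ?_
      push_cast
      simp only [Pi.neg_apply]
      have : (k : ℤ) - c ≤ s := by omega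
      nlinarith
  have hnx : (n : ℤ) • x ∈ shortRelations g (s * n + q) :=
    mem_shortRelations_of_dvd hn hnd fun i => by simp
  lift j to ℕ using hj.le
  have hcop : IsCoprime (j : ℤ) (n : ℤ) := by
    rw [Nat.isCoprime_iff_coprime]
    exact hpmin j (by omega) (by omega)
  -- Both j x and n x lie in the span, so Bézout recovers x.
  obtain ⟨u, v, huv⟩ := hcop
  have := Submodule.add_mem _ (Submodule.smul_mem _ u hy) (Submodule.smul_mem _ v hnx)
  rwa [smul_smul, smul_smul, ← add_smul, huv, one_smul] at this

end Relations

/-! ### Local generation by few members of a family -/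

section Nakayama

/-- A generating family of an `R`-module generated by `r` elements contains `r` members which
generate the module locally at a given maximal ideal. -/
theorem exists_card_le_smul_mem_span {R H S : Type*} [CommRing R] [AddCommGroup H] [Module R H]
    [Fintype S] (M : Ideal R) [hM : M.IsMaximal] (g : S → H)
    (hg : Submodule.span R (Set.range g) = ⊤)
    {r : ℕ} (h : Fin r → H)
    (hh : Submodule.span R (Set.range h) = ⊤) :
    ∃ T : Finset S, T.card ≤ r ∧ ∃ c : R, c ∉ M ∧
      ∀ x : H, c • x ∈ Submodule.span R (g '' T) := by
  classical
  let _ : Field (R ⧸ M) := Ideal.Quotient.field M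
  let Q := H ⧸ (M • ⊤ : Submodule R H)
  let π : H →ₗ[R] Q := Submodule.mkQ _
  have hsurj : Function.Surjective (algebraMap R (R ⧸ M)) := Ideal.Quotient.mk_surjective
  have key : ∀ X : Set H, (Submodule.span (R ⧸ M) (π '' X)).restrictScalars R =
      (Submodule.span R X).map π := by
    intro X
    rw [Submodule.restrictScalars_span R (R ⧸ M) hsurj, Submodule.map_span]
  have hπ : Submodule.map π ⊤ = ⊤ := by
    rw [Submodule.map_top, Submodule.range_mkQ]
  have htop : Submodule.span (R ⧸ M) (Set.range (π ∘ h)) = ⊤ := by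
    rw [← Submodule.restrictScalars_eq_top_iff R, Set.range_comp, key, hh, hπ]
  have htop' : Submodule.span (R ⧸ M) (Set.range (π ∘ g)) = ⊤ := by
    rw [← Submodule.restrictScalars_eq_top_iff R, Set.range_comp, key, hg, hπ]
  have hfr : Module.finrank (R ⧸ M) Q ≤ r := by
    have := finrank_range_le_card (R := R ⧸ M) (π ∘ h)
    rw [Set.finrank, htop, finrank_top] at this
    simpa using this
  have : Module.Finite (R ⧸ M) Q :=
    ⟨⟨(Set.finite_range (π ∘ h)).toFinset, by rw [Set.Finite.coe_toFinset, htop]⟩⟩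
  -- A subfamily forming a basis of H / M H has at most r members.
  obtain ⟨κ, a, ha, hspan, hli⟩ := exists_linearIndependent' (R ⧸ M) (π ∘ g)
  have : Finite κ := Finite.of_injective a ha
  have := Fintype.ofFinite κ
  refine ⟨Finset.univ.image a, ?_, ?_⟩
  · exact Finset.card_image_le.trans (by simpa using hli.fintype_card_le_finrank.trans hfr)
  · set K := Submodule.span R (g '' (Finset.univ.image a : Finset S)) with hK
    have hKtop : K.map π = ⊤ := by
      rw [hK, ← key, Submodule.restrictScalars_eq_top_iff, ← htop', ← hspan]
      congr 1
      ext y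
      simp
    have hfin : Module.Finite R H :=
      ⟨⟨(Set.finite_range h).toFinset, by rw [Set.Finite.coe_toFinset, hh]⟩⟩
    have hle : (⊤ : Submodule R (H ⧸ K)) ≤ M • ⊤ := by
      rintro y -
      obtain ⟨x, rfl⟩ := K.mkQ_surjective y
      obtain ⟨k, hk, hkx⟩ : π x ∈ K.map π := hKtop ▸ trivial
      have h1 : x - k ∈ (M • ⊤ : Submodule R H) := by
        rw [← Submodule.Quotient.mk_eq_zero, ← Submodule.mkQ_apply, map_sub]
        exact sub_eq_zero.2 hkx.symm
      have h2 := Submodule.mem_map_of_mem (f := K.mkQ) h1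
      rw [Submodule.map_smul'', Submodule.map_top, Submodule.range_mkQ, map_sub] at h2
      have h3 : K.mkQ k = 0 := by simpa using hk
      rwa [h3, sub_zero] at h2
    -- Nakayama: since H / K equals M (H / K), some c ≡ 1 mod M annihilates it.
    obtain ⟨c, hc, hc'⟩ := Submodule.exists_sub_one_mem_and_smul_eq_zero_of_fg_of_le_smul M ⊤
      (Module.Finite.fg_top (R := R) (M := H ⧸ K)) hle
    refine ⟨c, fun h => ?_, fun x => ?_⟩
    · exact hM.ne_top ((Ideal.eq_top_iff_one _).2 (by simpa using M.sub_mem h hc))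
    · have := hc' (K.mkQ x) trivial
      rwa [← map_smul, Submodule.mkQ_apply, Submodule.Quotient.mk_eq_zero] at this

end Nakayama

/-! ### Reduction to relations of small support -/

section Helly

variable {S A : Type*} [Fintype S] [AddCommGroup A]

/-- A relation lies in a submodule as soon as all relations supported on at most `r + 1` elements
do, where `r` is the number of generators of the ambient group. -/
theorem mem_of_forall_card_le {g : S → A} {r : ℕ} {f : (Fin r → ℤ) →ₗ[ℤ] A}
    (hf : Function.Surjective f) {N : Submodule ℤ (S → ℤ)}
    (hN : ∀ y : S → ℤ, ∑ i, y i • g i = 0 →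
      (Finset.univ.filter fun i => y i ≠ 0).card ≤ r + 1 → y ∈ N)
    {x : S → ℤ} (hx : ∑ i, x i • g i = 0) : x ∈ N := by
  classical
  -- The multipliers taking x into N form an ideal; it is everything once each maximal ideal misses
  -- one of them.
  let I : Ideal ℤ := N.comap (LinearMap.toSpanSingleton ℤ (S → ℤ) x)
  have hI : ∀ c : ℤ, c ∈ I ↔ c • x ∈ N := fun c => by simp [I]
  suffices I = ⊤ by simpa using (hI 1).1 (this ▸ trivial)
  by_contra hne
  obtain ⟨M, hM, hIM⟩ := Ideal.exists_le_maximal I hne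
  let H : Submodule ℤ A := Submodule.span ℤ (Set.range g)
  let g' : S → H := fun i => ⟨g i, Submodule.subset_span ⟨i, rfl⟩⟩
  have hg' : Submodule.span ℤ (Set.range g') = ⊤ := by
    exact Submodule.span_range_subtype_eq_top_iff _ _ |>.2 rfl
  -- The subgroup H is the image of a sublattice of ℤ^r, so it too needs at most r generators.
  obtain ⟨m, b⟩ := Submodule.basisOfPid (Pi.basisFun ℤ (Fin r)) (H.comap f)
  have hm : m ≤ r := by
    have h1 := Module.finrank_eq_card_basis b
    have h2 := Submodule.finrank_le (H.comap f)
    simp at h1 h2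
    omega
  let f' : H.comap f →ₗ[ℤ] H := f.restrict fun _ h => h
  have hf' : Function.Surjective f' := by
    rintro ⟨y, hy⟩
    obtain ⟨z, rfl⟩ := hf y
    exact ⟨⟨z, hy⟩, rfl⟩
  have hh : Submodule.span ℤ (Set.range (f' ∘ b)) = ⊤ := by
    rw [Set.range_comp, ← Submodule.map_span, b.span_eq, Submodule.map_top,
      LinearMap.range_eq_top.2 hf']
  obtain ⟨T, hT, c, hcM, hc⟩ := exists_card_le_smul_mem_span M g' hg' (f' ∘ b) hh
  have hrel : ∀ i, ∃ y : S → ℤ, (∀ k, k ∉ T → y k = 0) ∧ ∑ k, y k • g k = c • g i := by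
    intro i
    obtain ⟨y, hy'⟩ := (Submodule.mem_span_image_finset_iff_exists_fun' ℤ).1 (hc (g' i))
    refine ⟨fun k => if k ∈ T then y k else 0, fun k hk => if_neg hk, ?_⟩
    have := congrArg (Subtype.val) hy'
    simpa [g', ite_smul, Finset.sum_ite_mem] using this
  choose y hyT hy using hrel
  -- This relation expresses c g_i through T, so its support lies in T ∪ {i}.
  have hz : ∀ i, c • Pi.single i 1 - y i ∈ N := by
    intro i
    refine hN _ ?_ ?_
    · simp [sub_smul, hy, Finset.sum_sub_distrib, Pi.single_apply]
    · refine (Finset.card_le_card (t := insert i T) ?_).trans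
        ((Finset.card_insert_le _ _).trans (by omega))
      intro k hk
      by_contra hk'
      simp only [Finset.mem_insert, not_or] at hk'
      simp [hyT i k hk'.2, hk'.1] at hk
  have hcx : c • x - ∑ i, x i • y i ∈ N := by
    have : c • x - ∑ i, x i • y i = ∑ i, x i • (c • Pi.single i 1 - y i) := by
      ext k
      simp [Finset.sum_apply, mul_sub, Finset.sum_sub_distrib, Pi.single_apply, mul_comm]
    rw [this]
    exact Submodule.sum_mem _ fun i _ => Submodule.smul_mem _ _ (hz i)
  -- The remainder is supported on T, and it is a relation because its value is c ∑ x_i g_i = 0.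
  have hy0 : ∑ i, x i • y i ∈ N := by
    refine hN _ ?_ ?_
    · have : ∑ k, (∑ i, x i • y i) k • g k = ∑ i, x i • ∑ k, y i k • g k := by
        simp_rw [Finset.sum_apply, Finset.sum_smul, Finset.smul_sum]
        rw [Finset.sum_comm]
        simp [mul_smul]
      rw [this]
      simp_rw [hy, smul_comm _ c, ← Finset.smul_sum, hx, smul_zero]
    · refine (Finset.card_le_card (t := T) ?_).trans (by omega)
      intro k hk
      by_contra hk'
      simp [Finset.sum_apply, hyT _ k hk'] at hk
  refine hcM (hIM ((hI c).2 ?_))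
  simpa using Submodule.add_mem _ hcx hy0

end Helly

/-! ### Duality: from short relations to a group element -/

section Characters

theorem prod_pow_dite {S M : Type*} [Fintype S] [CommMonoid M] (P : S → Prop) [DecidablePred P]
    (m : Subtype P → ℕ) (u : S → M) :
    ∏ i, u i ^ (if hi : P i then m ⟨i, hi⟩ else 0) = ∏ i : Subtype P, u i ^ m i := by
  rw [← Fintype.prod_subtype_mul_prod_subtype P, ← mul_one (∏ i : Subtype P, u i ^ m i)]
  congr 1
  · exact Finset.prod_congr rfl fun i _ => by simp [i.2]
  · exact Finset.prod_eq_one fun i _ => by simp [i.2]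

/-- `|G|` times the projection onto the isotypic component of `χ`. -/
noncomputable def isotypicSum {G V : Type*} [CommGroup G] [Fintype G] [AddCommGroup V]
    [Module ℂ V]
    (ρ : Representation ℂ G V) (χ : G →* ℂˣ) : V →ₗ[ℂ] V :=
  ∑ g : G, ((χ g⁻¹ : ℂˣ) : ℂ) • ρ g

theorem isotypicSum_apply_rho {G V : Type*} [CommGroup G] [Fintype G] [AddCommGroup V]
    [Module ℂ V]
    (ρ : Representation ℂ G V) (χ : G →* ℂˣ) (h : G) (v : V) :
    isotypicSum ρ χ (ρ h v) = (χ h : ℂ) • isotypicSum ρ χ v := by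
  simp only [isotypicSum, LinearMap.sum_apply, LinearMap.smul_apply, Finset.smul_sum]
  rw [← Equiv.sum_comp (Equiv.mulRight h) (fun g => (χ h : ℂ) • ((χ g⁻¹ : ℂˣ) : ℂ) • ρ g v)]
  refine Finset.sum_congr rfl fun g _ => ?_
  simp [smul_smul]

variable {G : Type*} [CommGroup G] [Finite G]

/-- Every homomorphism from a free abelian group that vanishes on the relations between characters
of `G` is given by evaluation at an element of `G`. -/
theorem exists_forall_apply_eq {X : Type*} [CommGroup X] [Finite X] (e : X ≃* (G →* ℂˣ))
    {S : Type*} [Fintype S] (a : S → X) (z : S → ℂˣ)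
    (h : ∀ m : S → ℤ, ∏ i, a i ^ m i = 1 → ∏ i, z i ^ m i = 1) :
    ∃ g : G, ∀ i, e (a i) g = z i := by
  classical
  let Φ : Multiplicative (S → ℤ) →* X :=
    { toFun := fun m => ∏ i, a i ^ (Multiplicative.toAdd m) i
      map_one' := by simp
      map_mul' := fun a b => by simp [zpow_add, Finset.prod_mul_distrib] }
  let Z : Multiplicative (S → ℤ) →* ℂˣ :=
    { toFun := fun m => ∏ i, z i ^ (Multiplicative.toAdd m) i
      map_one' := by simp
      map_mul' := fun a b => by simp [zpow_add, Finset.prod_mul_distrib] }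
  have hker : Φ.rangeRestrict.ker ≤ Z.ker := by
    rw [MonoidHom.ker_rangeRestrict]
    exact fun m hm => h _ hm
  let η := Φ.rangeRestrict.liftOfSurjective Φ.rangeRestrict_surjective ⟨Z, hker⟩
  have hη : ∀ m, η (Φ.rangeRestrict m) = Z m := fun m =>
    MonoidHom.liftOfRightInverse_comp_apply _ _ (Function.rightInverse_surjInv _) ⟨Z, hker⟩ m
  -- The induced character of the subgroup generated by the a_i extends to X; by biduality it is
  -- then evaluation at an element of G.
  obtain ⟨θ, hθ⟩ := MonoidHom.domRestrict_surjective ℂ Φ.range η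
  refine ⟨CommGroup.monoidHomMonoidHomEquiv G ℂ (θ.comp e.symm.toMonoidHom), fun i => ?_⟩
  rw [CommGroup.apply_monoidHomMonoidHomEquiv]
  have h1 : Φ (Multiplicative.ofAdd (Pi.single i 1)) = a i := by
    simp only [Φ, MonoidHom.coe_mk, OneHom.coe_mk, toAdd_ofAdd]
    rw [Finset.prod_eq_single i] <;> simp +contextual
  have h2 : Z (Multiplicative.ofAdd (Pi.single i 1)) = z i := by
    simp only [Z, MonoidHom.coe_mk, OneHom.coe_mk, toAdd_ofAdd]
    rw [Finset.prod_eq_single i] <;> simp +contextual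
  have h3 := hη (Multiplicative.ofAdd (Pi.single i 1))
  rw [← hθ, h2] at h3
  rw [← h3]
  simp [h1]

theorem sum_monoidHom_apply [Fintype (G →* ℂˣ)] {g : G} (hg : g ≠ 1) :
    ∑ χ : G →* ℂˣ, (χ g : ℂ) = 0 := by
  obtain ⟨ψ, hψ⟩ := CommGroup.exists_apply_ne_one_of_hasEnoughRootsOfUnity G ℂ hg
  have h1 : ∑ χ : G →* ℂˣ, (χ g : ℂ) = ψ g * ∑ χ : G →* ℂˣ, (χ g : ℂ) := by
    rw [Finset.mul_sum, ← Equiv.sum_comp (Equiv.mulLeft ψ)]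
    simp
  have h2 : ((ψ g : ℂ) - 1) * ∑ χ : G →* ℂˣ, (χ g : ℂ) = 0 := by
    rw [sub_mul, one_mul, ← h1, sub_self]
  exact (mul_eq_zero.1 h2).resolve_left (sub_ne_zero.2 (by simpa using hψ))

/-- By orthogonality of characters, the isotypic sums of v add up to a nonzero multiple of v. -/
theorem eq_zero_of_isotypicSum_eq_zero {V : Type*} [AddCommGroup V] [Module ℂ V] [Fintype G]
    (ρ : Representation ℂ G V) (v : V) (h : ∀ χ, isotypicSum ρ χ v = 0) : v = 0 := by
  classical
  have : Finite (G →* ℂˣ) :=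
    Finite.of_equiv G (CommGroup.monoidHom_mulEquiv_of_hasEnoughRootsOfUnity G ℂ).some.symm.toEquiv
  have := Fintype.ofFinite (G →* ℂˣ)
  have h1 : ∑ χ : G →* ℂˣ, isotypicSum ρ χ v = (Fintype.card (G →* ℂˣ) : ℂ) • v := by
    simp only [isotypicSum, LinearMap.sum_apply, LinearMap.smul_apply]
    rw [Finset.sum_comm]
    simp_rw [← Finset.sum_smul]
    rw [Finset.sum_eq_single 1]
    · simp
    · intro g _ hg
      rw [sum_monoidHom_apply (by simpa using hg), zero_smul]
    · simp
  simp only [h, Finset.sum_const_zero] at h1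
  refine (smul_eq_zero.1 h1.symm).resolve_left ?_
  exact_mod_cast Fintype.card_ne_zero

/-- If the monomials of degree at most `s p q + q` that are invariant under the diagonal action of
`G` through the characters `χ i` agree on `v` and `w`, then `v` and `w` are in the same orbit. -/
theorem exists_forall_apply_mul_eq {r s p q : ℕ} {f : (Fin r → ℤ) →ₗ[ℤ] Additive G}
    (hf : Function.Surjective f) (hr : r = 2 * s) (hs : 1 ≤ s) (hp : 2 ≤ p) (hq : 0 < q)
    (hpmin : ∀ j, 0 < j → j < p → j.Coprime (p * q)) (hn : ∀ g : G, g ^ (p * q) = 1)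
    {S : Type*} [Fintype S] (χ : S → (G →* ℂˣ)) (v w : S → ℂ)
    (h : ∀ m : S → ℕ, ∑ i, m i ≤ s * (p * q) + q → ∏ i, χ i ^ m i = 1 →
      ∏ i, v i ^ m i = ∏ i, w i ^ m i) :
    ∃ g : G, ∀ i, (χ i g : ℂ) * v i = w i := by
  classical
  obtain ⟨e⟩ := CommGroup.monoidHom_mulEquiv_of_hasEnoughRootsOfUnity G ℂ
  let a : S → G := fun i => e (χ i)
  have ha : ∀ i, e.symm (a i) = χ i := fun i => e.symm_apply_apply _
  have hχ : ∀ χ : G →* ℂˣ, χ ^ (p * q) = 1 := fun χ => by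
    ext g
    rw [MonoidHom.pow_apply, ← map_pow, hn, map_one, MonoidHom.one_apply]
  -- The n-th power of a coordinate is invariant, of degree n ≤ s n + q.
  have hvw : ∀ i, v i = 0 ↔ w i = 0 := by
    intro i
    have h1 := h (Pi.single i (p * q)) (by
      rw [Finset.sum_pi_single']
      simp only [Finset.mem_univ, if_true]
      nlinarith [Nat.zero_le (p * q)]) (by
      refine Finset.prod_eq_one fun j _ => ?_
      by_cases hj : j = i
      · subst hj; simp [hχ]
      · rw [Pi.single_eq_of_ne hj]
        ext
        simp)
    have h2 : ∀ u : S → ℂ, ∏ j, u j ^ (Pi.single i (p * q) : S → ℕ) j = u i ^ (p * q) := by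
      intro u
      rw [Finset.prod_eq_single i] <;> simp +contextual
    rw [h2, h2] at h1
    have h3 : p * q ≠ 0 := by positivity
    rw [← pow_eq_zero_iff h3, h1, pow_eq_zero_iff h3]
  let S' := {i // v i ≠ 0}
  let z : S' → ℂˣ := fun i =>
    Units.mk0 (w i) (fun h => i.2 ((hvw i).2 h)) / Units.mk0 (v i) i.2
  let Z : (S' → ℤ) →ₗ[ℤ] Additive ℂˣ := Fintype.linearCombination ℤ fun i => Additive.ofMul (z i)
  have hZ : ∀ m, Z m = Additive.ofMul (∏ i, z i ^ m i) := fun m => by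
    simp [Z, Fintype.linearCombination_apply, ofMul_prod]
  have hrel : ∀ m : S' → ℤ, ∑ i, m i • Additive.ofMul (a (i : S)) =
      Additive.ofMul (∏ i : S', a i ^ m i) := fun m => by simp [ofMul_prod]
  have hshort : shortRelations (fun i : S' => Additive.ofMul (a i)) (s * (p * q) + q) ≤
      LinearMap.ker Z := by
    refine Submodule.span_le.2 ?_
    rintro m ⟨hm0, hmd, hm⟩
    lift m to S' → ℕ using hm0
    rw [hrel] at hm
    beta_reduce at hmd
    -- Extension by zero turns a short relation on the support into an invariant monomial on all
    -- coordinates.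
    let m' : S → ℕ := fun i => if hi : v i ≠ 0 then m ⟨i, hi⟩ else 0
    have hsum : ∑ i, m' i = ∑ i, m i := by
      rw [← Fintype.sum_subtype_add_sum_subtype (fun i => v i ≠ 0), ← add_zero (∑ i, m i)]
      congr 1
      · exact Finset.sum_congr rfl fun i _ => dif_pos i.2
      · exact Finset.sum_eq_zero fun i _ => dif_neg i.2
    have h1 := h m' (by rw [hsum]; exact_mod_cast hmd) (by
      rw [prod_pow_dite, ← e.map_eq_one_iff, map_prod]
      have h3 := congrArg Additive.toMul hm
      simp only [zpow_natCast, toMul_ofMul, toMul_zero] at h3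
      rw [← h3]
      exact Finset.prod_congr rfl fun i _ => map_pow _ _ _)
    rw [prod_pow_dite, prod_pow_dite] at h1
    have h2 : ∏ i, z i ^ m i = 1 := by
      ext
      simp only [z, div_pow, Finset.prod_div_distrib, Units.val_div_eq_div_val, Units.coe_prod,
        Units.val_pow_eq_pow_val, Units.val_mk0, Units.val_one]
      rw [← h1]
      exact div_self (Finset.prod_ne_zero_iff.2 fun i _ => pow_ne_zero (m i) i.2)
    rw [SetLike.mem_coe, LinearMap.mem_ker, hZ]
    simpa only [zpow_natCast, h2] using ofMul_one
  obtain ⟨g, hg⟩ := exists_forall_apply_eq e.symm (fun i : S' => a i) z (by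
    intro m hm
    have hx : m ∈ LinearMap.ker Z := by
      refine hshort (mem_of_forall_card_le (g := fun i : S' => Additive.ofMul (a i)) hf
        (fun y hy hcard => mem_shortRelations_of_card_le hs hp hq hpmin ?_ hy (hr ▸ hcard)) ?_)
      · exact fun b => congrArg Additive.ofMul (hn b.toMul)
      · rw [hrel, hm, ofMul_one]
    rw [LinearMap.mem_ker, hZ] at hx
    exact hx)
  refine ⟨g, fun i => ?_⟩
  by_cases hi : v i = 0
  · rw [hi, (hvw i).1 hi, mul_zero]
  · rw [← ha, hg ⟨i, hi⟩]
    simp [z, hi]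

end Characters

/-! ### The upper bound for an arbitrary representation -/

section UpperBound

variable {G : Type*} [CommGroup G] [Finite G]

/-- The coordinates of all isotypic sums are functionals on which G acts by characters, and jointly
they determine a vector. This redundant system replaces a diagonalisation of V. -/
theorem separatesOrbitsInDegree_of_surjective {r s p q : ℕ} {f : (Fin r → ℤ) →ₗ[ℤ] Additive G}
    (hf : Function.Surjective f) (hr : r = 2 * s) (hs : 1 ≤ s) (hp : 2 ≤ p) (hq : 0 < q)
    (hpmin : ∀ j, 0 < j → j < p → j.Coprime (p * q)) (hn : ∀ g : G, g ^ (p * q) = 1)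
    {V : Type*} [AddCommGroup V] [Module ℂ V] [FiniteDimensional ℂ V] (ρ : Representation ℂ G V) :
    SeparatesOrbitsInDegree ρ (s * (p * q) + q) := by
  classical
  intro v w hvw
  by_contra! hcon
  have := Fintype.ofFinite G
  have : Finite (G →* ℂˣ) :=
    Finite.of_equiv G (CommGroup.monoidHom_mulEquiv_of_hasEnoughRootsOfUnity G ℂ).some.symm.toEquiv
  have := Fintype.ofFinite (G →* ℂˣ)
  let b := Module.finBasis ℂ V
  let φ : Fin (Module.finrank ℂ V) × (G →* ℂˣ) → Module.Dual ℂ V :=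
    fun j => b.coord j.1 ∘ₗ isotypicSum ρ j.2
  have hφ : ∀ j g u, φ j (ρ g u) = (j.2 g : ℂ) * φ j u := fun j g u => by
    simp [φ, isotypicSum_apply_rho]
  obtain ⟨g, hg⟩ := exists_forall_apply_mul_eq hf hr hs hp hq hpmin hn
    (fun j : Fin (Module.finrank ℂ V) × (G →* ℂˣ) => j.2) (fun j => φ j v) (fun j => φ j w) (by
      intro m hm hχ
      refine hcon (∑ j, m j) (fun u => ∏ j, φ j u ^ m j) hm
        ⟨∏ j, MvPolynomial.X (φ j) ^ m j, ?_, ?_⟩ ?_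
      · refine MvPolynomial.IsHomogeneous.prod _ _ _ fun j _ => ?_
        simpa using (MvPolynomial.isHomogeneous_X ℂ (φ j)).pow (m j)
      · intro u
        simp
      · intro g u
        have h1 : ∏ j : Fin (Module.finrank ℂ V) × (G →* ℂˣ), (j.2 g : ℂ) ^ m j = 1 := by
          have := congrArg (fun χ : G →* ℂˣ => (χ g : ℂ)) hχ
          simpa [MonoidHom.finsetProd_apply] using this
        simp only [hφ, mul_pow, Finset.prod_mul_distrib, h1, one_mul])
  refine hvw ⟨g, sub_eq_zero.1 (eq_zero_of_isotypicSum_eq_zero ρ _ fun χ => ?_)⟩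
  rw [map_sub, sub_eq_zero]
  refine b.ext_elem fun i => ?_
  have h1 := hg (i, χ)
  rw [← hφ] at h1
  exact h1

end UpperBound

/-! ### A criterion for lower bounds from diagonal representations -/

section LowerBound

/-- The diagonal representation given by a family of characters. -/
def diagonalRep {G ι : Type*} [Group G] (χ : ι → (G →* ℂˣ)) : Representation ℂ G (ι → ℂ) where
  toFun g :=
    { toFun := fun u i => (χ i g : ℂ) * u i
      map_add' := fun u v => by ext; simp [mul_add]
      map_smul' := fun c u => by ext; simp [mul_left_comm] }
  map_one' := by ext; simp
  map_mul' g h := by ext; simp [mul_assoc]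

theorem diagonalRep_apply {G ι : Type*} [Group G] (χ : ι → (G →* ℂˣ)) (g : G) (u : ι → ℂ) (i : ι) :
    diagonalRep χ g u i = (χ i g : ℂ) * u i := rfl

/-- A homogeneous polynomial function on `ι → ℂ` is given by a homogeneous polynomial in the
coordinates. -/
theorem IsHomogeneousPolyFun.exists_eval {ι : Type*} [Fintype ι] {k : ℕ} {f : (ι → ℂ) → ℂ}
    (hf : IsHomogeneousPolyFun k f) :
    ∃ P : MvPolynomial ι ℂ, P.IsHomogeneous k ∧ ∀ u, f u = MvPolynomial.eval u P := by
  classical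
  obtain ⟨P, hP, hfP⟩ := hf
  let L : Module.Dual ℂ (ι → ℂ) → MvPolynomial ι ℂ :=
    fun φ => ∑ i, MvPolynomial.C (φ (Pi.single i 1)) * MvPolynomial.X i
  refine ⟨MvPolynomial.aeval L P, ?_, fun u => ?_⟩
  · have h1 := hP.aeval L (n := 1) fun φ => MvPolynomial.IsHomogeneous.sum _ _ _ fun i _ => by
      simpa using (MvPolynomial.isHomogeneous_C ι (φ (Pi.single i 1))).mul
        (MvPolynomial.isHomogeneous_X ℂ i)
    simpa using h1
  · rw [hfP, MvPolynomial.aeval_def, MvPolynomial.algebraMap_eq,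
      MvPolynomial.eval_eval₂]
    have h2 : (MvPolynomial.eval u).comp (MvPolynomial.C : ℂ →+* MvPolynomial ι ℂ) =
        RingHom.id ℂ := by
      ext; simp
    have h3 : ∀ φ : Module.Dual ℂ (ι → ℂ), MvPolynomial.eval u (L φ) = φ u := by
      intro φ
      conv_rhs => rw [← LinearMap.sum_single_apply (fun _ => ℂ) u, map_sum]
      simp only [L, map_sum, map_mul, MvPolynomial.eval_C, MvPolynomial.eval_X]
      refine Finset.sum_congr rfl fun i _ => ?_
      rw [← mul_one (u i), ← smul_eq_mul (u i) 1, Pi.single_smul', map_smul]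
      simp [mul_comm]
    rw [h2, MvPolynomial.eval₂_id]
    simp [h3]

/-- The monomials of an invariant polynomial of a diagonal representation are invariant. -/
theorem prod_pow_eq_one_of_coeff_ne_zero {G ι : Type*} [CommGroup G] [Fintype ι]
    (χ : ι → (G →* ℂˣ)) (P : MvPolynomial ι ℂ)
    (h : ∀ g u, MvPolynomial.eval (diagonalRep χ g u) P = MvPolynomial.eval u P)
    {m : ι →₀ ℕ} (hm : P.coeff m ≠ 0) : ∏ i, χ i ^ m i = 1 := by
  classical
  ext g
  let σ : MvPolynomial ι ℂ →ₐ[ℂ] MvPolynomial ι ℂ :=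
    MvPolynomial.aeval fun i => MvPolynomial.C (χ i g : ℂ) * MvPolynomial.X i
  have h1 : σ P = P := by
    refine MvPolynomial.funext fun u => ?_
    rw [← h g u, MvPolynomial.aeval_def, MvPolynomial.algebraMap_eq, MvPolynomial.eval_eval₂]
    have h2 : (MvPolynomial.eval u).comp (MvPolynomial.C : ℂ →+* MvPolynomial ι ℂ) =
        RingHom.id ℂ := by
      ext; simp
    rw [h2, MvPolynomial.eval₂_id]
    simp
    rfl
  -- Substituting the action of g scales each monomial by its own character value, so coefficients
  -- can be compared.
  have h2 : ∀ Q : MvPolynomial ι ℂ, (σ Q).coeff m = (∏ i, (χ i g : ℂ) ^ m i) * Q.coeff m := by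
    intro Q
    induction Q using MvPolynomial.induction_on' with
    | monomial a c =>
      have : σ (MvPolynomial.monomial a c) =
          MvPolynomial.monomial a ((∏ i, (χ i g : ℂ) ^ a i) * c) := by
        rw [MvPolynomial.aeval_monomial, Finsupp.prod_fintype _ _ (by simp)]
        simp only [mul_pow, Finset.prod_mul_distrib, ← map_pow, ← map_prod]
        rw [MvPolynomial.monomial_eq, Finsupp.prod_fintype _ _ (by simp),
          MvPolynomial.algebraMap_eq, map_mul]
        ring
      rw [this, MvPolynomial.coeff_monomial, MvPolynomial.coeff_monomial]
      split_ifs with h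
      · rw [h]
      · simp
    | add a b ha hb => simp [ha, hb, mul_add]
  have h3 := h2 P
  rw [h1] at h3
  have h4 := mul_right_cancel₀ hm ((one_mul _).trans h3)
  simpa [MonoidHom.finsetProd_apply] using h4.symm

/-- Compare (1, ..., 1) with the point having a primitive p-th root of unity ζ in place i₀.
Monomials of invariants of degree below D take the value 1 at both, whereas the relation x would
force ζ ^ x i₀ = 1 if the orbits coincided. -/
theorem le_betaSepRep_diagonalRep {G ι : Type*} [CommGroup G] [Fintype ι] (χ : ι → (G →* ℂˣ))
    {p D : ℕ} (hp : p ≠ 0) (i₀ : ι)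
    (hsmall : ∀ m : ι → ℕ, ∏ i, χ i ^ m i = 1 → ∑ i, m i < D → p ∣ m i₀)
    {x : ι → ℕ} (hx : ∏ i, χ i ^ x i = 1) (hx' : ¬ p ∣ x i₀) :
    (D : ℕ∞) ≤ betaSepRep (diagonalRep χ) := by
  classical
  obtain ⟨ζ, hζ⟩ : ∃ ζ : ℂ, IsPrimitiveRoot ζ p := ⟨_, Complex.isPrimitiveRoot_exp p hp⟩
  refine le_iInf₂ fun d hd => ?_
  by_contra hdD
  have hdD : d < D := by exact_mod_cast not_le.1 hdD
  have hprod : ∀ m : ι → ℕ, ∏ i, (Function.update (fun _ => 1) i₀ ζ : ι → ℂ) i ^ m i = ζ ^ m i₀ := by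
    intro m
    rw [Finset.prod_eq_single i₀] <;> simp +contextual
  obtain ⟨k, f, hk, hf, hinv, hne⟩ := hd.2 (fun _ => 1) (Function.update (fun _ => 1) i₀ ζ) (by
    rintro ⟨g, hg⟩
    have h1 : ∀ i, (χ i g : ℂ) = (Function.update (fun _ => 1) i₀ ζ : ι → ℂ) i := fun i => by
      rw [← hg, diagonalRep_apply, mul_one]
    have h2 := congrArg (fun χ : G →* ℂˣ => (χ g : ℂ)) hx
    simp only [MonoidHom.finsetProd_apply, MonoidHom.pow_apply, Units.coe_prod,
      Units.val_pow_eq_pow_val, h1, hprod, MonoidHom.one_apply, Units.val_one] at h2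
    exact hx' ((hζ.pow_eq_one_iff_dvd _).1 h2))
  obtain ⟨P, hP, hfP⟩ := hf.exists_eval
  refine hne ?_
  rw [hfP, hfP, MvPolynomial.eval_eq', MvPolynomial.eval_eq']
  refine Finset.sum_congr rfl fun m hm => ?_
  have hm' := MvPolynomial.mem_support_iff.1 hm
  have h1 := prod_pow_eq_one_of_coeff_ne_zero χ P (fun g u => by rw [← hfP, ← hfP, hinv]) hm'
  have h2 : ∑ i, m i = k := by
    rw [← Finsupp.degree_eq_sum, ← hP hm', Finsupp.degree_eq_weight_one]
    rfl
  rw [hprod, (hζ.pow_eq_one_iff_dvd _).2 (hsmall m h1 (by omega))]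
  simp

end LowerBound

/-! ### Characters of a product of cyclic groups -/

section ProductOfCyclicGroups

theorem map_sum_eq_prod {ι A M : Type*} [AddCommMonoid A] [CommMonoid M] (ψ : AddChar A M)
    (s : Finset ι) (f : ι → A) : ψ (∑ i ∈ s, f i) = ∏ i ∈ s, ψ (f i) :=
  map_prod ψ.toMonoidHom (fun i => Multiplicative.ofAdd (f i)) s

variable {κ : Type*} [Fintype κ] (N : κ → ℕ) [∀ k, NeZero (N k)]

/-- The character of `∏ k, ZMod (N k)` with exponent vector `c`. -/
noncomputable def piChar (c : κ → ℕ) : Multiplicative (∀ k, ZMod (N k)) →* ℂˣ :=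
  ∏ k, ((ZMod.stdAddChar (N := N k)).compAddMonoidHom
    (Pi.evalAddMonoidHom (fun k => ZMod (N k)) k)).toMonoidHom.toHomUnits ^ c k

theorem piChar_apply (c : κ → ℕ) (g : ∀ k, ZMod (N k)) :
    (piChar N c (Multiplicative.ofAdd g) : ℂ) = ∏ k, ZMod.stdAddChar ((c k : ZMod (N k)) * g k) := by
  simp only [piChar, MonoidHom.finsetProd_apply, MonoidHom.pow_apply, Units.coe_prod,
    Units.val_pow_eq_pow_val]
  refine Finset.prod_congr rfl fun k _ => ?_
  rw [← nsmul_eq_mul, AddChar.map_nsmul_eq_pow]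
  rfl

/-- The relations between the characters `piChar N (c j)`. -/
theorem prod_piChar_pow_eq_one_iff {ι : Type*} [Fintype ι] (c : ι → κ → ℕ) (m : ι → ℕ) :
    ∏ j, piChar N (c j) ^ m j = 1 ↔ ∀ k, N k ∣ ∑ j, m j * c j k := by
  classical
  have h : ∀ g : ∀ k, ZMod (N k),
      (((∏ j, piChar N (c j) ^ m j) (Multiplicative.ofAdd g) : ℂˣ) : ℂ) =
        ∏ k, ZMod.stdAddChar (((∑ j, m j * c j k : ℕ) : ZMod (N k)) * g k) := by
    intro g
    simp only [MonoidHom.finsetProd_apply, MonoidHom.pow_apply, Units.coe_prod,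
      Units.val_pow_eq_pow_val, piChar_apply, ← Finset.prod_pow]
    rw [Finset.prod_comm]
    refine Finset.prod_congr rfl fun k _ => ?_
    rw [Nat.cast_sum, Finset.sum_mul, map_sum_eq_prod]
    refine Finset.prod_congr rfl fun j _ => ?_
    rw [← AddChar.map_nsmul_eq_pow, nsmul_eq_mul]
    push_cast
    ring_nf
  constructor
  · intro h1 k
    -- Evaluating at the k-th standard generator isolates the k-th congruence, as the standard
    -- character is injective.
    have h2 := h (Pi.single k 1)
    rw [h1, Finset.prod_eq_single k] at h2
    · rw [Pi.single_eq_same, mul_one, MonoidHom.one_apply, Units.val_one,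
        ← AddChar.map_zero_eq_one (ZMod.stdAddChar (N := N k))] at h2
      exact (ZMod.natCast_eq_zero_iff _ _).1 (ZMod.injective_stdAddChar h2).symm
    · intro l _ hl
      rw [Pi.single_eq_of_ne hl, mul_zero, AddChar.map_zero_eq_one]
    · simp
  · intro h1
    refine MonoidHom.ext fun g => Units.ext ?_
    obtain ⟨g, rfl⟩ := Multiplicative.ofAdd.surjective g
    rw [h]
    simp [(ZMod.natCast_eq_zero_iff _ _).2 (h1 _)]

end ProductOfCyclicGroups

/-! ### The extremal characters -/

section ExtremalFamily

variable (s p : ℕ) (N : Fin (2 * s) → ℕ)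

/-- The exponent vectors of `2 s + 1` characters of `∏ k, ZMod (N k)`: in terms of the standard
basis `e`, they are `e i + (N (s + i) / p) e (s + i)` for `0 < i < s`, then
`e 0 - ∑ i < s, (N (s + i) / p) e (s + i)` up to a multiple of `N (s + i)` in each coordinate, then
`e i` for `i < s`, and `e s`. -/
def extremalExponent : Fin s ⊕ Fin s ⊕ Unit → Fin (2 * s) → ℕ
  | .inl i, k => if (k : ℕ) < s then (if (k : ℕ) = i then 1 else 0) else
      N k / p * ((if (i : ℕ) = 0 then p - 1 else 0) + if (i : ℕ) ≠ 0 ∧ (k : ℕ) = s + i then 1 else 0)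
  | .inr (.inl i), k => if (k : ℕ) = i then 1 else 0
  | .inr (.inr _), k => if (k : ℕ) = s then 1 else 0

variable {s p N}

theorem sum_mul_extremalExponent_lt (m : Fin s ⊕ Fin s ⊕ Unit → ℕ) (i : Fin s) {k : Fin (2 * s)}
    (hk : (k : ℕ) = i) :
    ∑ j, m j * extremalExponent s p N j k = m (.inl i) + m (.inr (.inl i)) := by
  simp only [Fintype.sum_sum_type, extremalExponent, hk, i.2, if_true, Fin.val_inj, i.2.ne, if_false]
  simp

theorem sum_mul_extremalExponent_mid (hs : 1 ≤ s) (m : Fin s ⊕ Fin s ⊕ Unit → ℕ) {k : Fin (2 * s)}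
    (hk : (k : ℕ) = s) :
    ∑ j, m j * extremalExponent s p N j k =
      N k / p * ((p - 1) * m (.inl ⟨0, hs⟩)) + m (.inr (.inr ())) := by
  have h1 : ∀ i : Fin s, ¬ ((i : ℕ) ≠ 0 ∧ s = s + i) := fun i => by have := i.2; omega
  have h2 : ∀ i : Fin s, ¬ (s = (i : ℕ)) := fun i => by have := i.2; omega
  have h3 : ∀ i : Fin s, (i : ℕ) = 0 ↔ i = ⟨0, hs⟩ := fun i => by simp [Fin.ext_iff]
  simp only [Fintype.sum_sum_type, extremalExponent, hk, lt_irrefl, if_false, h1, h2]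
  simp [h3]
  ring

theorem sum_mul_extremalExponent_gt (hs : 1 ≤ s) (m : Fin s ⊕ Fin s ⊕ Unit → ℕ)
    (i : Fin s) (hi : (i : ℕ) ≠ 0)
    {k : Fin (2 * s)} (hk : (k : ℕ) = s + i) :
    ∑ j, m j * extremalExponent s p N j k =
      N k / p * ((p - 1) * m (.inl ⟨0, hs⟩) + m (.inl i)) := by
  have h1 : ∀ j : Fin s, ((j : ℕ) ≠ 0 ∧ s + (i : ℕ) = s + j) ↔ j = i := fun j => by
    rw [Fin.ext_iff]; have := i.2; omega
  have h2 : ∀ j : Fin s, ¬ (s + (i : ℕ) = (j : ℕ)) := fun j => by have := j.2; omega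
  have h3 : ∀ i : Fin s, (i : ℕ) = 0 ↔ i = ⟨0, hs⟩ := fun i => by simp [Fin.ext_iff]
  have h4 : ¬ s + (i : ℕ) < s := by omega
  have h5 : ¬ s + (i : ℕ) = s := by omega
  simp only [Fintype.sum_sum_type, extremalExponent, hk, h4, h5, if_false, h1, h2]
  simp [h3, mul_add, Finset.sum_add_distrib]
  ring

/-- The relations between the characters given by `extremalExponent`. -/
theorem forall_dvd_sum_mul_extremalExponent_iff (hs : 1 ≤ s) {q : ℕ} (hp : 0 < p)
    (hN : ∀ k, 0 < N k)
    (hpN : ∀ k, p ∣ N k)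
    (hNn : ∀ k : Fin (2 * s), (k : ℕ) ≤ s → N k = p * q) (m : Fin s ⊕ Fin s ⊕ Unit → ℕ) :
    (∀ k, N k ∣ ∑ j, m j * extremalExponent s p N j k) ↔
      (∀ i, p * q ∣ m (.inl i) + m (.inr (.inl i))) ∧
      (p * q ∣ q * ((p - 1) * m (.inl ⟨0, hs⟩)) + m (.inr (.inr ()))) ∧
      ∀ i : Fin s, (i : ℕ) ≠ 0 → p ∣ (p - 1) * m (.inl ⟨0, hs⟩) + m (.inl i) := by
  -- The element N k / p has order p in the k-th factor.
  have hdiv : ∀ k a, N k ∣ N k / p * a ↔ p ∣ a := by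
    intro k a
    obtain ⟨M, hM⟩ := hpN k
    have hM0 : 0 < M := Nat.pos_of_mul_pos_left (hM ▸ hN k)
    rw [hM, Nat.mul_div_cancel_left _ hp, mul_comm p M, Nat.mul_dvd_mul_iff_left hM0]
  have hq : ∀ k : Fin (2 * s), (k : ℕ) ≤ s → N k / p = q := fun k hk => by
    rw [hNn k hk, Nat.mul_div_cancel_left _ hp]
  constructor
  · intro h
    refine ⟨fun i => ?_, ?_, fun i hi => ?_⟩
    · have := h ⟨i, by omega⟩
      rwa [sum_mul_extremalExponent_lt m i rfl, hNn _ i.2.le] at this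
    · have := h ⟨s, by omega⟩
      rwa [sum_mul_extremalExponent_mid hs m rfl, hq _ le_rfl, hNn _ le_rfl] at this
    · have := h ⟨s + i, by omega⟩
      rwa [sum_mul_extremalExponent_gt hs m i hi rfl, hdiv] at this
  · rintro ⟨h1, h2, h3⟩ k
    rcases lt_trichotomy (k : ℕ) s with hk | hk | hk
    · rw [sum_mul_extremalExponent_lt m ⟨k, hk⟩ rfl, hNn _ hk.le]
      exact h1 _
    · rw [sum_mul_extremalExponent_mid hs m hk, hq _ hk.le, hNn _ hk.le]
      exact h2
    · have hk2 : (k : ℕ) - s < s := by omega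
      rw [sum_mul_extremalExponent_gt hs m ⟨k - s, hk2⟩ (by simp; omega) (by simp; omega), hdiv]
      exact h3 _ (by simp; omega)

/-- If p does not divide the first coefficient, `h3` makes all the `.inl i` coefficients nonzero, so
each of the s pairs in `h1` sums to at least p q. By `h2` the last coefficient is a nonzero multiple
of q. -/
theorem le_sum_of_relations (hs : 1 ≤ s) {q : ℕ} (hp : p.Prime) (hq : 0 < q)
    (m : Fin s ⊕ Fin s ⊕ Unit → ℕ)
    (h1 : ∀ i, p * q ∣ m (.inl i) + m (.inr (.inl i)))
    (h2 : p * q ∣ q * ((p - 1) * m (.inl ⟨0, hs⟩)) + m (.inr (.inr ())))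
    (h3 : ∀ i : Fin s, (i : ℕ) ≠ 0 → p ∣ (p - 1) * m (.inl ⟨0, hs⟩) + m (.inl i))
    (h0 : ¬ p ∣ m (.inl ⟨0, hs⟩)) : s * (p * q) + q ≤ ∑ j, m j := by
  have hp1 : ¬ p ∣ (p - 1) * m (.inl ⟨0, hs⟩) := fun h => by
    rcases hp.dvd_mul.1 h with h | h
    · have := Nat.le_of_dvd (by have := hp.two_le; omega) h
      have := hp.two_le
      omega
    · exact h0 h
  have hne : ∀ i, m (.inl i) ≠ 0 := by
    intro i hi
    by_cases hi0 : (i : ℕ) = 0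
    · have : i = ⟨0, hs⟩ := Fin.ext hi0
      exact h0 (by rw [← this, hi]; exact dvd_zero p)
    · exact hp1 (by simpa [hi] using h3 i hi0)
  have hc : q ≤ m (.inr (.inr ())) := by
    have hdvd : q ∣ m (.inr (.inr ())) :=
      (Nat.dvd_add_right (dvd_mul_right q _)).1 ((dvd_mul_left q p).trans h2)
    refine Nat.le_of_dvd (Nat.pos_of_ne_zero fun h => ?_) hdvd
    rw [h, add_zero, mul_comm p q] at h2
    exact hp1 ((Nat.mul_dvd_mul_iff_left hq).1 h2)
  have hab : s * (p * q) ≤ ∑ i : Fin s, (m (.inl i) + m (.inr (.inl i))) := by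
    have := Finset.card_nsmul_le_sum Finset.univ
      (fun i : Fin s => m (.inl i) + m (.inr (.inl i))) (p * q) fun i _ =>
        Nat.le_of_dvd (by have := hne i; omega) (h1 i)
    simpa using this
  rw [Finset.sum_add_distrib] at hab
  simp only [Fintype.sum_sum_type, Finset.univ_unique, Finset.sum_singleton]
  change _ ≤ _ + (_ + m (.inr (.inr ())))
  omega

theorem le_betaSepRep_extremal (hs : 1 ≤ s) {q : ℕ} (hp : p.Prime) (hq : 0 < q) [∀ k, NeZero (N k)]
    (hpN : ∀ k, p ∣ N k) (hNn : ∀ k : Fin (2 * s), (k : ℕ) ≤ s → N k = p * q) :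
    ((s * (p * q) + q : ℕ) : ℕ∞) ≤
      betaSepRep (diagonalRep fun j => piChar N (extremalExponent s p N j)) := by
  have hiff := fun m => (prod_piChar_pow_eq_one_iff N (extremalExponent s p N) m).trans
    (forall_dvd_sum_mul_extremalExponent_iff hs hp.pos (fun k => Nat.pos_of_neZero _) hpN hNn m)
  have hp2 := hp.two_le
  have hpq : 1 ≤ p * q := Nat.mul_pos hp.pos hq
  refine le_betaSepRep_diagonalRep _ hp.ne_zero (.inl ⟨0, hs⟩) (fun m hm hlt => ?_)
    -- This relation attains equality: s pairs 1 + (p q - 1), and q.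
    (x := Sum.elim (fun _ => 1) (Sum.elim (fun _ => p * q - 1) fun _ => q)) ?_ ?_
  · obtain ⟨h1, h2, h3⟩ := (hiff m).1 hm
    by_contra h0
    exact absurd (le_sum_of_relations hs hp hq m h1 h2 h3 h0) (not_le.2 hlt)
  · refine (hiff _).2 ⟨fun i => ?_, ?_, fun i _ => ?_⟩
    · simp [Nat.add_sub_cancel' hpq]
    · refine dvd_of_eq ?_
      obtain ⟨t, rfl⟩ : ∃ t, p = t + 1 := ⟨p - 1, by omega⟩
      simp
      ring
    · simp [Nat.sub_add_cancel hp.one_le]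
  · simpa using hp.one_lt.ne'

end ExtremalFamily

/-! ### The separating Noether number -/

theorem theorem6p2 (s : ℕ) (hs : 1 ≤ s) (n : ℕ → ℕ)
    (hpos : 0 < n 1)
    (htwo : 2 ≤ n (2 * s))
    (hdvd : ∀ i : ℕ, 1 ≤ i → i < 2 * s → n (i + 1) ∣ n i)
    (heq : ∀ i : ℕ, 1 ≤ i → i ≤ s + 1 → n i = n 1)
    (p : ℕ) (hp : IsLeast {q : ℕ | q.Prime ∧ q ∣ n 1} p)
    (hpn : p ∣ n (2 * s)) :
    betaSep (Multiplicative ((i : Fin (2 * s)) → ZMod (n ((i : ℕ) + 1)))) =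
      ((s * n 1 + n 1 / p : ℕ) : ℕ∞) := by
  obtain ⟨⟨hpp, q, hq⟩, hmin⟩ := hp
  have hq0 : 0 < q := Nat.pos_of_ne_zero fun h => by simp [h] at hq; omega
  have hchain : ∀ i j, 1 ≤ i → i ≤ j → j ≤ 2 * s → n j ∣ n i := by
    intro i j hi hij
    induction j, hij using Nat.le_induction with
    | base => exact fun _ => dvd_rfl
    | succ j hij ih => exact fun hj => (hdvd j (by omega) (by omega)).trans (ih (by omega))
  let N : Fin (2 * s) → ℕ := fun k => n (k + 1)
  have hN1 : ∀ k, N k ∣ p * q := fun k => hq ▸ hchain 1 _ le_rfl (by omega) (by omega)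
  have hN0 : ∀ k, NeZero (N k) := fun k =>
    ⟨fun h => by have := hN1 k; rw [h, zero_dvd_iff, ← hq] at this; omega⟩
  have hpN : ∀ k, p ∣ N k := fun k => hpn.trans (hchain _ _ (by omega) (by omega) le_rfl)
  rw [hq, Nat.mul_div_cancel_left _ hpp.pos]
  change betaSep (Multiplicative (∀ k, ZMod (N k))) = _
  refine le_antisymm ?_ ?_
  · refine iSup_le fun V => iSup_le fun _ => iSup_le fun _ => iSup_le fun _ => iSup_le fun ρ => ?_
    refine iInf₂_le (s * (p * q) + q) ⟨by omega, ?_⟩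
    let f : (Fin (2 * s) → ℤ) →ₗ[ℤ] Additive (Multiplicative (∀ k, ZMod (N k))) :=
      AddMonoidHom.toIntLinearMap
        { toFun := fun x => Additive.ofMul (Multiplicative.ofAdd fun k => (x k : ZMod (N k)))
          map_zero' := by simp; rfl
          map_add' := fun x y => by simp; rfl }
    have hf : Function.Surjective f := fun y =>
      ⟨fun k => (ZMod.intCast_surjective (y.toMul.toAdd k)).choose,
        congrArg Additive.ofMul (congrArg Multiplicative.ofAdd
          (funext fun k => (ZMod.intCast_surjective (y.toMul.toAdd k)).choose_spec))⟩
    refine separatesOrbitsInDegree_of_surjective hf rfl hs hpp.two_le hq0 (fun j hj hjp => ?_)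
      (fun g => ?_) ρ
    -- A common prime factor of j and n would be at least p, yet at most j < p.
    · refine Nat.Coprime.symm (Nat.coprime_of_dvd fun r hr hr1 hr2 => ?_)
      have := hmin ⟨hr, hq ▸ hr1⟩
      have := Nat.le_of_dvd hj hr2
      omega
    · refine Multiplicative.toAdd.injective (funext fun k => ?_)
      change (p * q) • (Multiplicative.toAdd g k) = 0
      rw [nsmul_eq_mul, (ZMod.natCast_eq_zero_iff _ _).2 (hN1 k), zero_mul]
  · refine (le_betaSepRep_extremal hs hpp hq0 hpN fun k hk => ?_).trans ?_
    · exact (heq _ (by omega) (by omega)).trans hq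
    · exact le_iSup_of_le _ (le_iSup_of_le _ (le_iSup_of_le _ (le_iSup_of_le inferInstance
        (le_iSup_of_le _ le_rfl))))
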